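/- Let $n\ge 2$, let $\Omega\subset\mathbb R^n$ be open and connected, and let $\mathcal S^{n\times n}$ be the space of real symmetric $n\times n$ matrices. Let $U\subset\mathcal S^{n\times n}$ be an open set with $$0\in\partial U,\qquad U+\mathcal P\subset U,\qquad tU\subset U\ \text{ for all } t>0,$$ where $\mathcal P$ is the set of positive semidefinite matrices in $\mathcal S^{n\times n}$ (closures and boundaries are taken in $\mathcal S^{n\times n}$). Suppose that $U$ satisfies Condition $U_\nu$ for every unit vector $\nu\in\mathbb R^n$: there is $\mu=\mu(\nu)>0$ such that $U+C_\mu(\nu)\subset U$, where $$C_\mu(\nu)=\{t(\nu\otimes\nu+A): A\in\mathcal S^{n\times n},\ \|A\|<\mu,\ t>0\}.$$ Let $L:\Omega\times\mathbb R^n\to\mathcal S^{n\times n}$ be locally Lipschitz and let $F[\varphi]=\nabla^2\varphi+L(\cdot,\nabla\varphi)$ for $\varphi\in C^2(\Omega)$. Let $u,v:\Omega\to\mathbb R$ be locally Lipschitz with $u\ge v$ in $\Omega$. Suppose that $F[u]\in\mathcal S^{n\times n}\setminus U$ in $\Omega$ in the viscosity sense, that is, $F[\varphi](x_0)\in\mathcal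 S^{n\times n}\setminus U$ whenever $x_0\in\Omega$, $\varphi\in C^2(\Omega)$, $\varphi(x_0)=u(x_0)$ and $\varphi\le u$ near $x_0$; and that $F[v]\in\overline U$ in $\Omega$ in the viscosity sense, that is, $F[\varphi](x_0)\in\overline U$ whenever $x_0\in\Omega$, $\varphi\in C^2(\Omega)$, $\varphi(x_0)=v(x_0)$ and $\varphi\ge v$ near $x_0$. Then either $u>v$ everywhere in $\Omega$, or $u\equiv v$ in $\Omega$. -/

import Mathlib

open Set Filter Topology
open scoped Pointwise Gradient

noncomputable section

/-- Euclidean space `ℝⁿ`. -/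
abbrev Euc (n : ℕ) : Type := EuclideanSpace ℝ (Fin n)

/-- The space of all real symmetric `n × n` matrices. As a subtype it carries the topology induced
from the space of all `n × n` matrices; interiors, closures and boundaries of sets of symmetric
matrices are taken in this space. -/
def SymMat (n : ℕ) : Submodule ℝ (Matrix (Fin n) (Fin n) ℝ) where
  carrier := {A | A.IsSymm}
  add_mem' := fun hA hB => Matrix.IsSymm.add hA hB
  zero_mem' := Matrix.isSymm_zero
  smul_mem' := fun c _ hA => Matrix.IsSymm.smul hA c

/-- The set of all non-negative (that is, positive semidefinite) symmetric matrices. -/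
def nonnegMatrices (n : ℕ) : Set (SymMat n) :=
  {A | (A : Matrix (Fin n) (Fin n) ℝ).PosSemidef}

/-- The matrix `ν ⊗ ν`, with entries `ν i * ν j`. -/
def tensorSelf {n : ℕ} (ν : Euc n) : SymMat n :=
  ⟨Matrix.of fun i j => ν i * ν j, by
    apply Matrix.IsSymm.ext
    intro i j
    simp [mul_comm]⟩

/-- The operator norm of a symmetric matrix acting on Euclidean space. -/
def opNorm {n : ℕ} (A : SymMat n) : ℝ :=
  ‖Matrix.toEuclideanCLM (n := Fin n) (𝕜 := ℝ) (A : Matrix (Fin n) (Fin n) ℝ)‖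

/-- The set of all matrices `t (ν ⊗ ν + A)` with `A` symmetric, `‖A‖ < μ` and `t > 0`. -/
def halfCone {n : ℕ} (μ : ℝ) (ν : Euc n) : Set (SymMat n) :=
  {B | ∃ (t : ℝ) (A : SymMat n), 0 < t ∧ opNorm A < μ ∧ B = t • (tensorSelf ν + A)}

/-- Condition `U_ν`. -/
def ConditionU {n : ℕ} (U : Set (SymMat n)) (ν : Euc n) : Prop :=
  ∃ μ : ℝ, 0 < μ ∧ U + halfCone μ ν ⊆ U

/-- The Hessian `∇²φ(x)`, with entries the second partial derivatives of `φ` at `x`, as a symmetric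
matrix, for a function `φ` that is `C²` near `x`. -/
def hessian {n : ℕ} (φ : Euc n → ℝ) (x : Euc n) (hφ : ContDiffAt ℝ 2 φ x) : SymMat n :=
  ⟨Matrix.of fun i j =>
      fderiv ℝ (fderiv ℝ φ) x (EuclideanSpace.single i 1) (EuclideanSpace.single j 1), by
    apply Matrix.IsSymm.ext
    intro i j
    exact (hφ.isSymmSndFDerivAt (by simp)) _ _⟩

/-- The operator `F[φ](x) = ∇²φ(x) + L(x, ∇φ(x))`. -/
def opF {n : ℕ} (L : Euc n × Euc n → SymMat n) (φ : Euc n → ℝ) (x : Euc n)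
    (hφ : ContDiffAt ℝ 2 φ x) : SymMat n :=
  hessian φ x hφ + L (x, ∇ φ x)

/-- `F[u] ∈ S ∖ U` in the open set `Ω`, in the viscosity sense: this is tested with functions
`φ ∈ C²(Ω)` that touch `u` from below. -/
def ViscosityNotMem {n : ℕ} (L : Euc n × Euc n → SymMat n) (U : Set (SymMat n))
    (Ω : Set (Euc n)) (u : Euc n → ℝ) : Prop :=
  ∀ x₀ ∈ Ω, ∀ φ : Euc n → ℝ, ContDiffOn ℝ 2 φ Ω → φ x₀ = u x₀ →
    (∀ᶠ x in 𝓝 x₀, φ x ≤ u x) →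
      ∀ hφ : ContDiffAt ℝ 2 φ x₀, opF L φ x₀ hφ ∈ Uᶜ

/-- `F[v] ∈ closure U` in the open set `Ω`, in the viscosity sense: this is tested with functions
`φ ∈ C²(Ω)` that touch `v` from above. -/
def ViscosityMemClosure {n : ℕ} (L : Euc n × Euc n → SymMat n) (U : Set (SymMat n))
    (Ω : Set (Euc n)) (v : Euc n → ℝ) : Prop :=
  ∀ x₀ ∈ Ω, ∀ φ : Euc n → ℝ, ContDiffOn ℝ 2 φ Ω → φ x₀ = v x₀ →
    (∀ᶠ x in 𝓝 x₀, v x ≤ φ x) →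
      ∀ hφ : ContDiffAt ℝ 2 φ x₀, opF L φ x₀ hφ ∈ closure U

/-- `L ∈ C^{0,1}_loc(Ω × ℝⁿ)` for a matrix-valued `L`: every entry is locally Lipschitz. -/
def LocLipMatrix {n : ℕ} (Ω : Set (Euc n)) (L : Euc n × Euc n → SymMat n) : Prop :=
  ∀ i j : Fin n, LocallyLipschitzOn (Ω ×ˢ (univ : Set (Euc n)))
    (fun p => (L p : Matrix (Fin n) (Fin n) ℝ) i j)

end

open MeasureTheory Module
open scoped NNReal RealInnerProductSpace

/-! This is a Hopf-type argument. If both alternatives fail, connectedness yields a ball on which `v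
< u`, with a contact point `x₀` on its boundary; `false_of_interior_ball` shows that this is
impossible. With `ν` the inner normal at `x₀`, the barrier `h = s + α s² - κ |z - x₀|²`, `s = ⟪ν, z
- x₀⟫`, is negative on the part of a small sphere outside the ball. Hence `v + η h < u` on that
sphere for small `η`, with equality at the centre. The Hessian of `η h` is `2ηα (ν ⊗ ν)` minus a
term independent of `α`. For large `α` Condition `U_ν` absorbs that term and the change in `L`, and
pushes `F` from `closure U` into `U`.

Since `u` and `v` are only Lipschitz, `v` and `-u` are replaced by quadratic sup-convolutions. After
adding `l/2 |x|²` these are convex, being maxima of affine functions. Alexandrov's theorem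
(`IsSubgradientSelection.ae_differentiableAt`, `IsSubgradientSelection.taylor`) gives second-order
expansions almost everywhere, and Jensen's lemma (`hausdorffMeasure_touching_ne_zero`) gives a set
of near-maximum points of positive measure. `exists_twice_differentiable_near_max` combines the two.
At such a point the viscosity conditions apply to explicit quadratic polynomials at translated
points, and the resulting matrices contradict each other. -/

lemma LipschitzOnWith.hausdorffMeasure_image_eq_zero {X Y : Type*} [MetricSpace X] [MetricSpace Y]
    [MeasurableSpace X] [BorelSpace X] [MeasurableSpace Y] [BorelSpace Y] {f : X → Y} {s : Set X}
    {K : ℝ≥0} {d : ℕ}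
    (hf : LipschitzOnWith K f s) (hs : μH[d] s = 0) : μH[d] (f '' s) = 0 := by
  have := hf.hausdorffMeasure_image_le (d := d) (by positivity)
  rw [hs, mul_zero] at this
  exact le_antisymm this zero_le

/-! ### Convex functions: subgradients and Alexandrov's theorem -/

section Convex

variable {E : Type*} [NormedAddCommGroup E] [InnerProductSpace ℝ E]

/-- `S` selects a subgradient of `c` at every point. -/
def IsSubgradientSelection (c : E → ℝ) (S : E → E) : Prop :=
  ∀ x y, c x + ⟪S x, y - x⟫ ≤ c y

lemma IsSubgradientSelection.monotone {c : E → ℝ} {S : E → E} (h : IsSubgradientSelection c S)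
    (x y : E) : 0 ≤ ⟪S x - S y, x - y⟫ := by
  have h1 := h x y
  have h2 := h y x
  have h3 : y - x = -(x - y) := by abel
  rw [h3, inner_neg_right] at h1
  rw [inner_sub_left]
  linarith

lemma IsSubgradientSelection.lipschitz {c : E → ℝ} {S : E → E} (h : IsSubgradientSelection c S)
    {K : ℝ≥0} (hK : ∀ x, ‖S x‖ ≤ K) : LipschitzWith K c := by
  apply LipschitzWith.of_le_add_mul
  intro x y
  have h1 := h x y
  have h2 : |⟪S x, y - x⟫| ≤ ‖S x‖ * ‖y - x‖ := abs_real_inner_le_norm _ _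
  have h3 : ‖S x‖ * ‖y - x‖ ≤ K * ‖y - x‖ := by gcongr; exact hK x
  rw [dist_comm, dist_eq_norm]
  have := neg_abs_le ⟪S x, y - x⟫
  linarith

/-- Monotonicity of `S` and Cauchy–Schwarz. The inverse of `id + S` is therefore Lipschitz on its
range, so that differentiability of `S` can be read off from Rademacher's theorem for this inverse.
-/
lemma IsSubgradientSelection.antilipschitz {c : E → ℝ} {S : E → E}
    (h : IsSubgradientSelection c S) : AntilipschitzWith 1 (fun x => x + S x) := by
  apply AntilipschitzWith.of_le_mul_dist
  intro x y
  simp only [NNReal.coe_one, one_mul, dist_eq_norm]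
  have h1 := h.monotone x y
  have h2 : ⟪x - y, x - y⟫ ≤ ⟪(x + S x) - (y + S y), x - y⟫ := by
    have : (x + S x) - (y + S y) = (x - y) + (S x - S y) := by abel
    rw [this, inner_add_left]
    linarith
  have h3 := real_inner_le_norm ((x + S x) - (y + S y)) (x - y)
  rw [real_inner_self_eq_norm_sq] at h2
  rcases (norm_nonneg (x - y)).eq_or_lt with h0 | h0
  · rw [← h0]; positivity
  · nlinarith

/-- A bounded subgradient selection is continuous wherever the function is differentiable. -/
lemma IsSubgradientSelection.continuousAt {c : E → ℝ} {S : E → E}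
    (h : IsSubgradientSelection c S) {K : ℝ≥0} (hK : ∀ x, ‖S x‖ ≤ K) [CompleteSpace E] {x : E}
    (hx : DifferentiableAt ℝ c x) : ContinuousAt S x := by
  have hc := h.lipschitz hK
  set p := ∇ c x with hp
  have hgrad : HasGradientAt c p x := hx.hasGradientAt
  have key : ∀ ε > 0, ∀ᶠ y in 𝓝 x, ‖S y - p‖ ≤ ε := by
    intro ε hε
    have h1 := (hasGradientAt_iff_isLittleO.1 hgrad).def (half_pos hε)
    rw [Metric.eventually_nhds_iff] at h1
    obtain ⟨ρ, hρ, h1⟩ := h1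
    have hρ2 : 0 < ρ / 2 := half_pos hρ
    -- With this radius, moving the base point from `x` to `y` changes `c` by at most a quarter of
    -- `ε * (ρ / 2)`. This is paid twice, at `y` and at `y + (ρ / 2) • e`; the other half of `ε` is
    -- the differentiability error at `x`.
    have hδ : 0 < ε * (ρ / 2) / (4 * (K + 1)) := by positivity
    filter_upwards [Metric.ball_mem_nhds x hδ] with y hy
    rw [mem_ball_iff_norm] at hy
    rcases eq_or_ne (S y - p) 0 with h0 | h0
    · rw [h0, norm_zero]; exact hε.le
    have hn : 0 < ‖S y - p‖ := norm_pos_iff.2 h0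
    set e := (‖S y - p‖)⁻¹ • (S y - p) with he
    have hen : ‖e‖ = 1 := by
      rw [he, norm_smul, norm_inv, norm_norm, inv_mul_cancel₀ hn.ne']
    have hie : ⟪S y - p, e⟫ = ‖S y - p‖ := by
      rw [he, inner_smul_right, real_inner_self_eq_norm_sq]
      field_simp
    have hd : dist (x + (ρ / 2) • e) x < ρ := by
      rw [dist_eq_norm, add_sub_cancel_left, norm_smul, hen, mul_one, Real.norm_eq_abs,
        abs_of_pos hρ2]
      linarith
    have h2 := h1 hd
    rw [add_sub_cancel_left, norm_smul, hen, mul_one, Real.norm_eq_abs, Real.norm_eq_abs,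
      abs_of_pos hρ2, inner_smul_right] at h2
    have h3 := h y (y + (ρ / 2) • e)
    rw [add_sub_cancel_left, inner_smul_right] at h3
    have h4 := hc.dist_le_mul (y + (ρ / 2) • e) (x + (ρ / 2) • e)
    have h5 := hc.dist_le_mul y x
    rw [dist_add_right] at h4
    rw [Real.dist_eq, dist_eq_norm] at h4 h5
    have h6 := abs_le.1 h2
    have h7 := abs_le.1 h4
    have h8 := abs_le.1 h5
    rw [inner_sub_left] at hie
    have h9 : K * ‖y - x‖ ≤ ε * (ρ / 2) / 4 := by
      have : K * ‖y - x‖ ≤ (K + 1) * (ε * (ρ / 2) / (4 * (K + 1))) := by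
        gcongr
        linarith
      refine this.trans (le_of_eq ?_)
      have : (K : ℝ) + 1 ≠ 0 := by positivity
      field_simp
    rw [← hie]
    have h10 : (ρ / 2) * (⟪S y, e⟫ - ⟪p, e⟫) ≤ (ρ / 2) * ε := by nlinarith
    exact le_of_mul_le_mul_left h10 hρ2
  have hpx : S x = p := by
    by_contra hne
    have h0 : 0 < ‖S x - p‖ := norm_pos_iff.2 (sub_ne_zero.2 hne)
    have := (key _ (half_pos h0)).self_of_nhds
    linarith
  rw [Metric.continuousAt_iff']
  intro ε hε
  filter_upwards [key (ε / 2) (half_pos hε)] with y hy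
  rw [hpx, dist_eq_norm]
  linarith

section FiniteDim
variable [FiniteDimensional ℝ E] [MeasurableSpace E] [BorelSpace E]

/-- A subgradient selection of a Lipschitz convex function is differentiable almost everywhere
(Alexandrov). -/
theorem IsSubgradientSelection.ae_differentiableAt {c : E → ℝ} {S : E → E}
    (h : IsSubgradientSelection c S) {K : ℝ≥0} (hK : ∀ x, ‖S x‖ ≤ K) :
    ∀ᵐ x ∂(μH[finrank ℝ E] : Measure E), DifferentiableAt ℝ S x := by
  set F : E → E := fun x => x + S x with hF
  have hanti : AntilipschitzWith 1 F := h.antilipschitz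
  have hinv : Function.LeftInverse (Function.invFun F) F :=
    Function.leftInverse_invFun hanti.injective
  have hlip : LipschitzOnWith 1 (Function.invFun F) (range F) := by
    apply LipschitzOnWith.of_dist_le_mul
    rintro _ ⟨x, rfl⟩ _ ⟨y, rfl⟩
    rw [hinv x, hinv y]
    exact hanti.le_mul_dist x y
  -- Surjectivity of `F` is not needed: the inverse is extended from the range to a Lipschitz map on
  -- the whole space.
  obtain ⟨J, hJ, hJF⟩ := hlip.extend_finite_dimension
  have hJF' : ∀ x, J (F x) = x := fun x => by
    rw [← hJF (mem_range_self x), hinv x]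
  have h1 := (h.lipschitz hK).ae_differentiableAt (μ := (μH[finrank ℝ E] : Measure E))
  have h2 : ∀ᵐ x ∂(μH[finrank ℝ E] : Measure E), x ∉ J '' {z | ¬ DifferentiableAt ℝ J z} := by
    rw [ae_iff]
    simp only [not_not, ofPred_mem_eq]
    apply LipschitzOnWith.hausdorffMeasure_image_eq_zero hJ.lipschitzOnWith
    exact hJ.ae_differentiableAt (μ := (μH[finrank ℝ E] : Measure E))
  -- Sard's theorem for `J`: its critical values form a null set. Off this set and the one in `h2`,
  -- `J` has an invertible derivative at `F x`, and `F` is differentiable at `x` as its local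
  -- inverse.
  have h3 : ∀ᵐ x ∂(μH[finrank ℝ E] : Measure E),
      x ∉ J '' {z | DifferentiableAt ℝ J z ∧ (fderiv ℝ J z).det = 0} := by
    rw [ae_iff]
    simp only [not_not, ofPred_mem_eq]
    exact addHaar_image_eq_zero_of_det_fderivWithin_eq_zero _
      (fun z hz => hz.1.hasFDerivAt.hasFDerivWithinAt) (fun z hz => hz.2)
  filter_upwards [h1, h2, h3] with x hx1 hx2 hx3
  have hd : DifferentiableAt ℝ J (F x) := by
    by_contra hcon
    exact hx2 ⟨F x, hcon, hJF' x⟩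
  have hdet : (fderiv ℝ J (F x)).det ≠ 0 := fun hcon => hx3 ⟨F x, ⟨hd, hcon⟩, hJF' x⟩
  have hS := h.continuousAt hK hx1
  have hFd : HasFDerivAt F
      (((fderiv ℝ J (F x)).toContinuousLinearEquivOfDetNeZero hdet).symm : E →L[ℝ] E) x := by
    apply HasFDerivAt.of_local_left_inverse (f := J)
    · exact continuousAt_id.add hS
    · simpa using hd.hasFDerivAt
    · exact Eventually.of_forall hJF'
  have : S = fun y => F y - y := by
    ext1 y; simp [hF]
  rw [this]
  exact hFd.differentiableAt.sub differentiableAt_id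

end FiniteDim

/-- A convex function whose subgradients have slope close to `a + t b` along a segment is close to
a quadratic polynomial there. -/
lemma IsSubgradientSelection.abs_segment_le {c : E → ℝ} {S : E → E}
    (h : IsSubgradientSelection c S) (hc : Continuous c) {x k : E} {a b η : ℝ}
    (hη : ∀ t ∈ Icc (0 : ℝ) 1, |⟪S (x + t • k), k⟫ - (a + t * b)| ≤ η) :
    |c (x + k) - c x - a - b / 2| ≤ η := by
  set f : ℝ → ℝ := fun t => c (x + t • k) with hf
  have hfc : Continuous f := by fun_prop
  have hslope : ∀ t s : ℝ, t < s → ⟪S (x + t • k), k⟫ ≤ slope f t s ∧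
      slope f t s ≤ ⟪S (x + s • k), k⟫ := by
    intro t s hts
    have h1 := h (x + t • k) (x + s • k)
    have h2 := h (x + s • k) (x + t • k)
    have e1 : x + s • k - (x + t • k) = (s - t) • k := by rw [sub_smul]; abel
    have e2 : x + t • k - (x + s • k) = (t - s) • k := by rw [sub_smul]; abel
    rw [e1, inner_smul_right] at h1
    rw [e2, inner_smul_right] at h2
    rw [slope_def_field]
    have hpos : 0 < s - t := sub_pos.2 hts
    constructor
    · rw [le_div_iff₀ hpos]; simp only [hf]; nlinarith
    · rw [div_le_iff₀ hpos]; simp only [hf]; nlinarith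
  have hB : ∀ (e d b t : ℝ), HasDerivAt (fun t : ℝ => e + d * t + b / 2 * t ^ 2)
      (d + b * t) t := by
    intro e d b t
    exact ((((hasDerivAt_id t).const_mul d).const_add e).add
      (((hasDerivAt_id t).pow 2).const_mul (b / 2))).congr_deriv (by simp; ring)
  -- Difference quotients of `f` lie between the subgradient slopes at the two endpoints, so
  -- one-sided comparison with a quadratic needs no differentiability of `f`.
  have up : f 1 ≤ c x + (a + η) * 1 + b / 2 * 1 ^ 2 := by
    refine image_le_of_liminf_slope_right_le_deriv_boundary (a := 0) (b := 1) hfc.continuousOn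
      (B := fun t => c x + (a + η) * t + b / 2 * t ^ 2) (B' := fun t => (a + η) + b * t) ?_ ?_ ?_ ?_
      (right_mem_Icc.2 zero_le_one)
    · simp [hf]
    · fun_prop
    · intro t ht
      exact (hB _ _ _ _).hasDerivWithinAt
    · intro t ht r hr
      apply Eventually.frequently
      have h1 : ∀ᶠ s in 𝓝[>] t, (a + η) + b * s < r := by
        have : Tendsto (fun s : ℝ => (a + η) + b * s) (𝓝 t) (𝓝 ((a + η) + b * t)) :=
          Continuous.tendsto (by fun_prop) t
        exact nhdsWithin_le_nhds (this.eventually_lt_const hr)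
      filter_upwards [h1, Ioo_mem_nhdsGT ht.2] with s hs1 hs2
      have h2 := (hslope t s hs2.1).2
      have h3 := (abs_le.1 (hη s ⟨ht.1.trans hs2.1.le, hs2.2.le⟩)).2
      nlinarith
  have low : -f 1 ≤ -c x + (-a + η) * 1 + (-b) / 2 * 1 ^ 2 := by
    refine image_le_of_liminf_slope_right_le_deriv_boundary (a := 0) (b := 1)
      (f := fun t => - f t) hfc.neg.continuousOn
      (B := fun t => -c x + (-a + η) * t + (-b) / 2 * t ^ 2) (B' := fun t => (-a + η) + (-b) * t)
      ?_ ?_ ?_ ?_ (right_mem_Icc.2 zero_le_one)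
    · simp [hf]
    · fun_prop
    · intro t ht
      exact (hB _ _ _ _).hasDerivWithinAt
    · intro t ht r hr
      apply Eventually.frequently
      filter_upwards [Ioo_mem_nhdsGT ht.2] with s hs2
      have h2 := (hslope t s hs2.1).1
      have h3 := (abs_le.1 (hη t ⟨ht.1, ht.2.le⟩)).1
      have h4 : slope (fun t => -f t) t s = - slope f t s := by
        rw [slope_def_field, slope_def_field]; ring
      rw [h4]
      linarith
  have hf1 : f 1 = c (x + k) := by simp [hf]
  rw [hf1] at up low
  rw [abs_le]
  constructor <;> linarith

/-- Second-order expansion of a convex function at a point of differentiability of a subgradient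
selection. -/
theorem IsSubgradientSelection.taylor {c : E → ℝ} {S : E → E}
    (h : IsSubgradientSelection c S) (hc : Continuous c) {x : E} {A : E →L[ℝ] E}
    (hA : HasFDerivAt S A x) {ε : ℝ} (hε : 0 < ε) :
    ∀ᶠ k in 𝓝 (0 : E), |c (x + k) - c x - ⟪S x, k⟫ - ⟪A k, k⟫ / 2| ≤ ε * ‖k‖ ^ 2 := by
  have h1 := (hasFDerivAt_iff_isLittleO_nhds_zero.1 hA).def hε
  rw [Metric.eventually_nhds_iff] at h1 ⊢
  obtain ⟨ρ, hρ, h1⟩ := h1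
  refine ⟨ρ, hρ, fun k hk => h.abs_segment_le hc fun t ht => ?_⟩
  rw [dist_zero_right] at hk
  have htk : ‖t • k‖ ≤ ‖k‖ := by
    rw [norm_smul, Real.norm_eq_abs, abs_of_nonneg ht.1]
    exact mul_le_of_le_one_left (norm_nonneg _) ht.2
  have h2 := h1 (y := t • k) (by rw [dist_zero_right]; exact htk.trans_lt hk)
  have h3 : ⟪S (x + t • k), k⟫ - (⟪S x, k⟫ + t * ⟪A k, k⟫)
      = ⟪S (x + t • k) - S x - A (t • k), k⟫ := by
    rw [inner_sub_left, inner_sub_left, map_smul, real_inner_smul_left]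
    ring
  rw [h3]
  calc _ ≤ ‖S (x + t • k) - S x - A (t • k)‖ * ‖k‖ := abs_real_inner_le_norm _ _
    _ ≤ (ε * ‖k‖) * ‖k‖ := by
      gcongr
      exact h2.trans (by gcongr)
    _ = _ := by ring

/-! ### Jensen's lemma and approximate maxima -/

/-- A uniform lower quadratic bound and a touching affine function from above determine the slope. -/
lemma eq_of_touching {w : E → ℝ} {x a p : E} {M : ℝ} {s : Set E} (hs : s ∈ 𝓝 x)
    (hlow : ∀ z ∈ s, w x + ⟪a, z - x⟫ - M / 2 * ‖z - x‖ ^ 2 ≤ w z)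
    (hup : ∀ z ∈ s, w z ≤ w x + ⟪p, z - x⟫) : a = p := by
  by_contra hne
  have h0 : 0 < ‖a - p‖ ^ 2 := by
    have := norm_pos_iff.2 (sub_ne_zero.2 hne)
    positivity
  have hlim : Tendsto (fun t : ℝ => x + t • (a - p)) (𝓝[>] 0) (𝓝 x) := by
    have : Tendsto (fun t : ℝ => x + t • (a - p)) (𝓝 0) (𝓝 (x + (0 : ℝ) • (a - p))) :=
      Continuous.tendsto (by fun_prop) 0
    rw [zero_smul, add_zero] at this
    exact this.mono_left nhdsWithin_le_nhds
  have hlim2 : Tendsto (fun t : ℝ => M / 2 * t) (𝓝[>] 0) (𝓝 0) := by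
    have : Tendsto (fun t : ℝ => M / 2 * t) (𝓝 0) (𝓝 (M / 2 * 0)) :=
      Continuous.tendsto (by fun_prop) 0
    rw [mul_zero] at this
    exact this.mono_left nhdsWithin_le_nhds
  obtain ⟨t, ht1, ht2, ht3⟩ := ((hlim.eventually hs).and ((hlim2.eventually_lt_const one_pos).and
    self_mem_nhdsWithin)).exists
  have h1 := hlow _ ht1
  have h2 := hup _ ht1
  have ht : 0 < t := ht3
  rw [add_sub_cancel_left, inner_smul_right, norm_smul, mul_pow, Real.norm_eq_abs, sq_abs] at h1
  rw [add_sub_cancel_left, inner_smul_right] at h2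
  have h3 : ⟪a, a - p⟫ - ⟪p, a - p⟫ = ‖a - p‖ ^ 2 := by
    rw [← inner_sub_left, real_inner_self_eq_norm_sq]
  have h4 : t * ‖a - p‖ ^ 2 ≤ t * ((M / 2 * t) * ‖a - p‖ ^ 2) := by nlinarith
  have h5 := le_of_mul_le_mul_left h4 ht
  nlinarith

/-- Slopes at which a semiconvex function is touched from above by affine functions depend on the
point in a Lipschitz way. -/
lemma norm_slope_sub_le {w : E → ℝ} {x y p q : E} {M : ℝ} {s : Set E}
    (hs : Metric.closedBall x ‖x - y‖ ⊆ s)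
    (hlow : ∀ z ∈ s, w y + ⟪q, z - y⟫ - M / 2 * ‖z - y‖ ^ 2 ≤ w z)
    (hp : ∀ z ∈ s, w z ≤ w x + ⟪p, z - x⟫) (hq : ∀ z ∈ s, w z ≤ w y + ⟪q, z - y⟫) (hM : 0 ≤ M)
    (hxy : x ≠ y) :
    ‖q - p‖ ≤ 2 * M * ‖x - y‖ := by
  rcases eq_or_ne q p with h0 | h0
  · rw [h0, sub_self, norm_zero]; positivity
  have hn : 0 < ‖q - p‖ := norm_pos_iff.2 (sub_ne_zero.2 h0)
  set t := ‖x - y‖ with htdef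
  have ht : 0 < t := norm_pos_iff.2 (sub_ne_zero.2 hxy)
  set e := (‖q - p‖)⁻¹ • (q - p) with he
  have hen : ‖e‖ = 1 := by
    rw [he, norm_smul, norm_inv, norm_norm, inv_mul_cancel₀ hn.ne']
  have hie : ⟪q - p, e⟫ = ‖q - p‖ := by
    rw [he, inner_smul_right, real_inner_self_eq_norm_sq]
    field_simp
  have hte : ‖t • e‖ = t := by
    rw [norm_smul, hen, mul_one, Real.norm_eq_abs, abs_of_pos ht]
  -- Test point: move from `x` by the distance `t = ‖x - y‖` in the direction of `q - p`. The gain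
  -- `t * ‖q - p‖` is then bounded by the semiconvexity error `M / 2 * (2 * t) ^ 2`.
  have hz : x + t • e ∈ s := hs (by rw [mem_closedBall_iff_norm, add_sub_cancel_left, hte])
  have hx : x ∈ s := hs (Metric.mem_closedBall_self ht.le)
  have h1 := hlow _ hz
  have h2 := hp _ hz
  have h3 := hq _ hx
  have e1 : x + t • e - y = (x - y) + t • e := by abel
  rw [add_sub_cancel_left] at h2
  rw [e1, inner_add_right] at h1
  have h4 : ‖(x - y) + t • e‖ ^ 2 ≤ (2 * t) ^ 2 := by
    gcongr
    calc _ ≤ ‖x - y‖ + ‖t • e‖ := norm_add_le _ _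
      _ = 2 * t := by rw [hte]; ring
  rw [inner_sub_left] at hie
  rw [inner_smul_right] at h1 h2
  have h5 : t * ‖q - p‖ ≤ t * (2 * M * t) := by
    rw [← hie]
    nlinarith [mul_le_mul_of_nonneg_left h4 hM]
  exact le_of_mul_le_mul_left h5 ht

section FiniteDim
variable [FiniteDimensional ℝ E] [MeasurableSpace E] [BorelSpace E]

/-- Jensen's lemma: near a strict maximum of a semiconvex function, the points at which it is
touched from above by affine functions of small slope form a set of positive measure. -/
theorem hausdorffMeasure_touching_ne_zero {w : E → ℝ} {T : E → E} {M r δ : ℝ} {x₀ : E} (hM : 0 ≤ M)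
    (hr : 0 < r) (hδ : 0 < δ) (hw : ContinuousOn w (Metric.closedBall x₀ r))
    (hT : ∀ y ∈ Metric.closedBall x₀ r, ∀ z ∈ Metric.closedBall x₀ r,
      w y + ⟪T y, z - y⟫ - M / 2 * ‖z - y‖ ^ 2 ≤ w z)
    (hs : ∀ z ∈ Metric.sphere x₀ r, w z < w x₀) :
    (μH[finrank ℝ E] : Measure E) {x | x ∈ Metric.ball x₀ r ∧ ‖T x‖ ≤ δ ∧
      ∀ z ∈ Metric.closedBall x₀ r, w z ≤ w x + ⟪T x, z - x⟫} ≠ 0 := by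
  obtain ⟨m, hm, hms⟩ := (isCompact_sphere x₀ r).exists_forall_le' (f := fun z => w x₀ - w z) (a := 0)
    (continuousOn_const.sub (hw.mono Metric.sphere_subset_closedBall))
    (fun z hz => sub_pos.2 (hs z hz))
  set C : Set E := {z ∈ Metric.closedBall x₀ r | w x₀ - m / 2 ≤ w z} with hC
  have hCc : IsCompact C :=
    (isCompact_closedBall x₀ r).of_isClosed_subset
      (hw.preimage_isClosed_of_isClosed Metric.isClosed_closedBall isClosed_Ici) inter_subset_left
  have hCb : C ⊆ Metric.ball x₀ r := by
    rintro z ⟨hz1, hz2⟩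
    by_contra hz3
    have hz4 : z ∈ Metric.sphere x₀ r := by
      rw [Metric.mem_sphere]
      exact le_antisymm hz1 (not_lt.1 hz3)
    have := hms z hz4
    linarith
  obtain ⟨d, hd, hdC⟩ := hCc.exists_cthickening_subset_open Metric.isOpen_ball hCb
  set δ' := min δ (m / 2 / r) with hδ'
  have hδ'0 : 0 < δ' := lt_min hδ (by positivity)
  set K : Set E := {x | x ∈ C ∧ ‖T x‖ ≤ δ ∧
      ∀ z ∈ Metric.closedBall x₀ r, w z ≤ w x + ⟪T x, z - x⟫} with hK
  -- Every small slope `p` is attained at a maximizer of `w - ⟪p, ·⟫`. As `T` is Lipschitz on `K`, a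
  -- null `K` would make this ball null.
  have himage : Metric.ball 0 δ' ⊆ T '' K := by
    intro p hp
    rw [mem_ball_zero_iff] at hp
    obtain ⟨x, hx, hmax⟩ := (isCompact_closedBall x₀ r).exists_isMaxOn
      ⟨x₀, Metric.mem_closedBall_self hr.le⟩ (f := fun z => w z - ⟪p, z⟫)
      (hw.sub (by fun_prop))
    have hmax' : ∀ z ∈ Metric.closedBall x₀ r, w z ≤ w x + ⟪p, z - x⟫ := by
      intro z hz
      have : w z - ⟪p, z⟫ ≤ w x - ⟪p, x⟫ := hmax hz
      rw [inner_sub_right]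
      linarith
    have hxC : x ∈ C := by
      refine ⟨hx, ?_⟩
      have h1 := hmax' x₀ (Metric.mem_closedBall_self hr.le)
      have h2 := real_inner_le_norm p (x₀ - x)
      have h3 : ‖p‖ * ‖x₀ - x‖ ≤ (m / 2 / r) * r := by
        rw [mem_closedBall_iff_norm'] at hx
        gcongr
        exact hp.le.trans (min_le_right _ _)
      rw [div_mul_cancel₀ _ hr.ne'] at h3
      linarith
    have hTx : T x = p := eq_of_touching
      (mem_of_superset (Metric.isOpen_ball.mem_nhds (hCb hxC)) Metric.ball_subset_closedBall)
      (hT x hx) hmax'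
    refine ⟨x, ⟨hxC, ?_, ?_⟩, hTx⟩
    · rw [hTx]; exact hp.le.trans (min_le_left _ _)
    · rw [hTx]; exact hmax'
  have hLip : LipschitzOnWith (Real.toNNReal (2 * M + 2 * δ / d)) T K := by
    apply LipschitzOnWith.of_dist_le_mul
    intro y hy x hx
    rw [Real.coe_toNNReal _ (by positivity), dist_eq_norm, dist_eq_norm, norm_sub_rev y x]
    rcases eq_or_ne x y with hne | hne
    · simp [hne]
    -- Close points have room for the test ball of `norm_slope_sub_le`; for distant points the bound
    -- `2 * δ` on the difference of slopes suffices.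
    rcases le_or_gt ‖x - y‖ d with hxy | hxy
    · have h1 : Metric.closedBall x ‖x - y‖ ⊆ Metric.closedBall x₀ r :=
        ((Metric.closedBall_subset_closedBall hxy).trans
          (Metric.closedBall_subset_cthickening hx.1 d)).trans
          (hdC.trans Metric.ball_subset_closedBall)
      have h2 := norm_slope_sub_le h1 (hT y hy.1.1) hx.2.2 hy.2.2 hM hne
      refine h2.trans ?_
      have : 0 ≤ 2 * δ / d := by positivity
      gcongr
      linarith
    · have h1 : ‖T y - T x‖ ≤ 2 * δ := by
        have := norm_sub_le (T y) (T x)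
        linarith [hy.2.1, hx.2.1]
      have h2 : 2 * δ / d * d ≤ (2 * M + 2 * δ / d) * ‖x - y‖ := by
        gcongr
        linarith
      rw [div_mul_cancel₀ _ hd.ne'] at h2
      exact h1.trans h2
  intro hzero
  have hK0 : (μH[finrank ℝ E] : Measure E) K = 0 :=
    by
    refine measure_mono_null ?_ hzero
    intro x hx
    exact ⟨hCb hx.1, hx.2⟩
  have h1 := measure_mono_null himage (hLip.hausdorffMeasure_image_eq_zero hK0)
  exact (Metric.measure_ball_pos (μH[finrank ℝ E] : Measure E) 0 hδ'0).ne' h1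

/-- Near a strict maximum of the sum of two convex functions and a quadratic polynomial, there is a
point where both convex functions are twice differentiable and the usual necessary conditions for a
maximum are approximately satisfied. -/
theorem exists_twice_differentiable_near_max {c₁ c₂ : E → ℝ} {S₁ S₂ : E → E} {K₁ K₂ : ℝ≥0}
    (h₁ : IsSubgradientSelection c₁ S₁) (hK₁ : ∀ x, ‖S₁ x‖ ≤ K₁)
    (h₂ : IsSubgradientSelection c₂ S₂) (hK₂ : ∀ x, ‖S₂ x‖ ≤ K₂)
    (Q : E →L[ℝ] E) (hQ : ∀ x y, ⟪Q x, y⟫ = ⟪Q y, x⟫) (b x₀ : E) {r δ : ℝ} (hr : 0 < r) (hδ : 0 < δ)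
    (hs : ∀ z ∈ Metric.sphere x₀ r,
      c₁ z + c₂ z + (⟪b, z - x₀⟫ + ⟪Q (z - x₀), z - x₀⟫ / 2) < c₁ x₀ + c₂ x₀) :
    ∃ x ∈ Metric.ball x₀ r, ∃ A₁ A₂ : E →L[ℝ] E, HasFDerivAt S₁ A₁ x ∧ HasFDerivAt S₂ A₂ x ∧
      ‖S₁ x + S₂ x + (b + Q (x - x₀))‖ ≤ δ ∧
      ∀ k, ⟪A₁ k, k⟫ + ⟪A₂ k, k⟫ + ⟪Q k, k⟫ ≤ 0 := by
  have hc₁ := (h₁.lipschitz hK₁).continuous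
  have hc₂ := (h₂.lipschitz hK₂).continuous
  set w : E → ℝ := fun z => c₁ z + c₂ z + (⟪b, z - x₀⟫ + ⟪Q (z - x₀), z - x₀⟫ / 2) with hw
  set T : E → E := fun x => S₁ x + S₂ x + (b + Q (x - x₀)) with hT
  have hwc : Continuous w := by fun_prop
  have hq : ∀ y z, ⟪b, z - x₀⟫ + ⟪Q (z - x₀), z - x₀⟫ / 2
      = ⟪b, y - x₀⟫ + ⟪Q (y - x₀), y - x₀⟫ / 2 + ⟪b + Q (y - x₀), z - y⟫
        + ⟪Q (z - y), z - y⟫ / 2 := by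
    intro y z
    have e : z - x₀ = (y - x₀) + (z - y) := by abel
    rw [e, map_add, inner_add_right, inner_add_left, inner_add_right, inner_add_right,
      inner_add_left, hQ (z - y) (y - x₀)]
    ring
  have hlow : ∀ y z, w y + ⟪T y, z - y⟫ - ‖Q‖ / 2 * ‖z - y‖ ^ 2 ≤ w z := by
    intro y z
    have e1 := h₁ y z
    have e2 := h₂ y z
    have e3 := hq y z
    have e4 : -(‖Q‖ * ‖z - y‖ ^ 2) ≤ ⟪Q (z - y), z - y⟫ := by
      have := neg_abs_le ⟪Q (z - y), z - y⟫
      have h' : |⟪Q (z - y), z - y⟫| ≤ ‖Q‖ * ‖z - y‖ * ‖z - y‖ :=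
        (abs_real_inner_le_norm _ _).trans (by gcongr; exact Q.le_opNorm _)
      nlinarith
    simp only [hw, hT]
    rw [e3, inner_add_left, inner_add_left]
    linarith
  have hw0 : w x₀ = c₁ x₀ + c₂ x₀ := by simp [hw]
  have hJ := hausdorffMeasure_touching_ne_zero (w := w) (T := T) (norm_nonneg Q) hr hδ
    hwc.continuousOn (fun y _ z _ => hlow y z) (fun z hz => by rw [hw0]; exact hs z hz)
  have hfr : ∃ᵐ x ∂(μH[finrank ℝ E] : Measure E), x ∈ Metric.ball x₀ r ∧ ‖T x‖ ≤ δ ∧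
      ∀ z ∈ Metric.closedBall x₀ r, w z ≤ w x + ⟪T x, z - x⟫ :=
    frequently_ae_iff.2 hJ
  obtain ⟨x, ⟨hxb, hTx, hmax⟩, hd₁, hd₂⟩ := (hfr.and_eventually
    ((h₁.ae_differentiableAt hK₁).and (h₂.ae_differentiableAt hK₂))).exists
  obtain ⟨A₁, hA₁⟩ := hd₁
  obtain ⟨A₂, hA₂⟩ := hd₂
  refine ⟨x, hxb, A₁, A₂, hA₁, hA₂, hTx, fun k => ?_⟩
  have hball : ∀ᶠ k in 𝓝 (0 : E), x + k ∈ Metric.closedBall x₀ r := by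
    have : Tendsto (fun k : E => x + k) (𝓝 0) (𝓝 (x + 0)) := Continuous.tendsto (by fun_prop) 0
    rw [add_zero] at this
    exact this (mem_of_superset (Metric.isOpen_ball.mem_nhds hxb) Metric.ball_subset_closedBall)
  have key : ∀ ε > 0, ∀ᶠ k in 𝓝 (0 : E),
      ⟪A₁ k, k⟫ + ⟪A₂ k, k⟫ + ⟪Q k, k⟫ ≤ 4 * ε * ‖k‖ ^ 2 := by
    intro ε hε
    filter_upwards [h₁.taylor hc₁ hA₁ hε, h₂.taylor hc₂ hA₂ hε, hball] with k hk1 hk2 hk3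
    have e1 := hmax _ hk3
    have e2 := hq x (x + k)
    simp only [hw, hT] at e1
    rw [e2, add_sub_cancel_left, inner_add_left, inner_add_left, inner_add_left] at e1
    have e3 := (abs_le.1 hk1).1
    have e4 := (abs_le.1 hk2).1
    have e5 := inner_add_left (𝕜 := ℝ) b (Q (x - x₀)) k
    linarith
  have hscale : Tendsto (fun t : ℝ => t • k) (𝓝[>] 0) (𝓝 0) := by
    have : Tendsto (fun t : ℝ => t • k) (𝓝 0) (𝓝 ((0 : ℝ) • k)) :=
      Continuous.tendsto (by fun_prop) 0
    rw [zero_smul] at this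
    exact this.mono_left nhdsWithin_le_nhds
  -- Both sides are homogeneous of degree two, so the estimate for small `k` holds for every `k`.
  have hall : ∀ ε > 0, ⟪A₁ k, k⟫ + ⟪A₂ k, k⟫ + ⟪Q k, k⟫ ≤ 4 * ε * ‖k‖ ^ 2 := by
    intro ε hε
    obtain ⟨t, ht1, ht2⟩ := ((hscale.eventually (key ε hε)).and self_mem_nhdsWithin).exists
    have ht : 0 < t := ht2
    simp only [map_smul, real_inner_smul_left, inner_smul_right, norm_smul, mul_pow,
      Real.norm_eq_abs, sq_abs] at ht1
    have : t ^ 2 * (⟪A₁ k, k⟫ + ⟪A₂ k, k⟫ + ⟪Q k, k⟫) ≤ t ^ 2 * (4 * ε * ‖k‖ ^ 2) := by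
      linarith
    exact le_of_mul_le_mul_left this (by positivity)
  by_contra! hpos
  set a := ⟪A₁ k, k⟫ + ⟪A₂ k, k⟫ + ⟪Q k, k⟫
  have := hall (a / (8 * (‖k‖ ^ 2 + 1))) (by positivity)
  have h3 : 4 * (a / (8 * (‖k‖ ^ 2 + 1))) * ‖k‖ ^ 2 ≤ a / 2 := by
    have : 4 * (a / (8 * (‖k‖ ^ 2 + 1))) * ‖k‖ ^ 2 = (a / 2) * (‖k‖ ^ 2 / (‖k‖ ^ 2 + 1)) := by
      field_simp; ring
    rw [this]
    apply mul_le_of_le_one_right (by positivity)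
    rw [div_le_one (by positivity)]
    linarith
  linarith

end FiniteDim

/-! ### Quadratic sup-convolutions as convex functions -/

/-- The quadratic sup-convolution of a continuous function over a compact set, with a selection of
the points where the supremum is attained. -/
theorem exists_sup_convolution {B : Set E} (hB : IsCompact B) (hne : B.Nonempty) {v : E → ℝ}
    (hv : ContinuousOn v B) (l : ℝ) :
    ∃ Z : E → E, (∀ x, Z x ∈ B) ∧ ∀ x, ∀ z ∈ B, v z + l * ⟪z, x⟫ - l / 2 * ‖z‖ ^ 2
      ≤ v (Z x) + l * ⟪Z x, x⟫ - l / 2 * ‖Z x‖ ^ 2 := by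
  have : ∀ x : E, ∃ z' ∈ B, ∀ z ∈ B, v z + l * ⟪z, x⟫ - l / 2 * ‖z‖ ^ 2
      ≤ v z' + l * ⟪z', x⟫ - l / 2 * ‖z'‖ ^ 2 := by
    intro x
    obtain ⟨z', hz', hmax⟩ := hB.exists_isMaxOn hne
      (f := fun z => v z + l * ⟪z, x⟫ - l / 2 * ‖z‖ ^ 2)
      ((hv.add (by fun_prop)).sub (by fun_prop))
    exact ⟨z', hz', fun z hz => hmax hz⟩
  choose Z hZ hmax using this
  exact ⟨Z, hZ, hmax⟩

/-- The function is a maximum of affine functions of `x`, and the slope of the active one is a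
subgradient. It equals `max_z (v z - l/2 |z - x|²)` plus `l/2 |x|²`. -/
lemma isSubgradientSelection_sup_convolution {B : Set E} {v : E → ℝ} {l : ℝ} {Z : E → E}
    (hZ : ∀ x, Z x ∈ B) (hmax : ∀ x, ∀ z ∈ B, v z + l * ⟪z, x⟫ - l / 2 * ‖z‖ ^ 2
      ≤ v (Z x) + l * ⟪Z x, x⟫ - l / 2 * ‖Z x‖ ^ 2) :
    IsSubgradientSelection (fun x => v (Z x) + l * ⟪Z x, x⟫ - l / 2 * ‖Z x‖ ^ 2)
      (fun x => l • Z x) := by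
  intro x y
  have := hmax y (Z x) (hZ x)
  simp only [real_inner_smul_left, inner_sub_right]
  linarith

end Convex

/-! ### Symmetric matrices, the set `U`, and quadratic test functions -/

section Matrices

variable {n : ℕ}

lemma opNorm_add_le (A B : SymMat n) : opNorm (A + B) ≤ opNorm A + opNorm B := by
  unfold opNorm
  rw [Submodule.coe_add, map_add]
  exact norm_add_le _ _

lemma opNorm_smul (c : ℝ) (A : SymMat n) : opNorm (c • A) = |c| * opNorm A := by
  unfold opNorm
  rw [Submodule.coe_smul, map_smul, norm_smul, Real.norm_eq_abs]

lemma continuous_opNorm : Continuous (opNorm : SymMat n → ℝ) := by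
  let f : SymMat n →ₗ[ℝ] (Euc n →L[ℝ] Euc n) :=
    { toFun := fun A => Matrix.toEuclideanCLM (n := Fin n) (𝕜 := ℝ) (A : Matrix (Fin n) (Fin n) ℝ)
      map_add' := fun A B => map_add _ _ _
      map_smul' := fun c A => map_smul _ _ _ }
  exact continuous_norm.comp (LinearMap.continuous_of_finiteDimensional f)

lemma EuclideanSpace.norm_le_sum_abs (y : Euc n) : ‖y‖ ≤ ∑ i, |y i| := by
  have : y = ∑ i, y i • EuclideanSpace.single i (1 : ℝ) := by
    ext j
    simp [Finset.sum_apply, Pi.single_apply]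
  calc ‖y‖ = ‖∑ i, y i • EuclideanSpace.single i (1 : ℝ)‖ := by rw [← this]
    _ ≤ ∑ i, ‖y i • EuclideanSpace.single i (1 : ℝ)‖ := norm_sum_le _ _
    _ = _ := by simp [norm_smul]

lemma opNorm_le_sum_abs (A : SymMat n) :
    opNorm A ≤ ∑ i, ∑ j, |(A : Matrix (Fin n) (Fin n) ℝ) i j| := by
  refine ContinuousLinearMap.opNorm_le_bound _ (by positivity) fun x => ?_
  refine (EuclideanSpace.norm_le_sum_abs _).trans ?_
  rw [Finset.sum_mul]
  refine Finset.sum_le_sum fun i _ => ?_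
  have : (Matrix.toEuclideanCLM (n := Fin n) (𝕜 := ℝ) (A : Matrix (Fin n) (Fin n) ℝ) x) i
      = ∑ j, (A : Matrix (Fin n) (Fin n) ℝ) i j * x j := rfl
  rw [this, Finset.sum_mul]
  refine (Finset.abs_sum_le_sum_abs _ _).trans (Finset.sum_le_sum fun j _ => ?_)
  rw [abs_mul]
  gcongr
  exact PiLp.norm_apply_le x j

/-- The symmetric matrix of the quadratic form `k ↦ ⟪A k, k⟫`. -/
noncomputable def symOp (A : Euc n →L[ℝ] Euc n) : SymMat n :=
  ⟨Matrix.of fun i j => (⟪A (EuclideanSpace.single i 1), EuclideanSpace.single j 1⟫ +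
      ⟪A (EuclideanSpace.single j 1), EuclideanSpace.single i 1⟫) / 2, by
    apply Matrix.IsSymm.ext
    intro i j
    simp only [Matrix.of_apply]
    rw [add_comm]⟩

lemma symOp_apply (A : Euc n →L[ℝ] Euc n) (i j : Fin n) :
    (symOp A : Matrix (Fin n) (Fin n) ℝ) i j =
      (⟪A (EuclideanSpace.single i 1), EuclideanSpace.single j 1⟫ +
      ⟪A (EuclideanSpace.single j 1), EuclideanSpace.single i 1⟫) / 2 := rfl

lemma symOp_add (A B : Euc n →L[ℝ] Euc n) : symOp (A + B) = symOp A + symOp B := by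
  ext i j
  simp only [symOp_apply, Submodule.coe_add, Matrix.add_apply, _root_.add_apply,
    inner_add_left]
  ring

lemma symOp_smul (c : ℝ) (A : Euc n →L[ℝ] Euc n) : symOp (c • A) = c • symOp A := by
  ext i j
  simp only [symOp_apply, Submodule.coe_smul, Matrix.smul_apply, _root_.smul_apply,
    real_inner_smul_left, smul_eq_mul]
  ring

lemma symOp_neg (A : Euc n →L[ℝ] Euc n) : symOp (-A) = -symOp A := by
  rw [← neg_one_smul ℝ A, symOp_smul, neg_one_smul ℝ (symOp A)]

lemma symOp_sub (A B : Euc n →L[ℝ] Euc n) : symOp (A - B) = symOp A - symOp B := by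
  rw [sub_eq_add_neg, symOp_add, symOp_neg, sub_eq_add_neg]

lemma opNorm_symOp_id_le : opNorm (symOp (ContinuousLinearMap.id ℝ (Euc n))) ≤ 1 := by
  have : (symOp (ContinuousLinearMap.id ℝ (Euc n)) : Matrix (Fin n) (Fin n) ℝ) = 1 := by
    ext i j
    rw [symOp_apply]
    simp [Matrix.one_apply, EuclideanSpace.inner_single_left, eq_comm]
  unfold opNorm
  rw [this, map_one]
  exact ContinuousLinearMap.norm_id_le

lemma symOp_smulRight (ν : Euc n) : symOp ((innerSL ℝ ν).smulRight ν) = tensorSelf ν := by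
  ext i j
  rw [symOp_apply]
  simp [tensorSelf, EuclideanSpace.inner_single_right]
  ring

lemma symOp_mem_nonnegMatrices {A : Euc n →L[ℝ] Euc n} (hA : ∀ k, 0 ≤ ⟪A k, k⟫) :
    symOp A ∈ nonnegMatrices n := by
  refine Matrix.PosSemidef.of_dotProduct_mulVec_nonneg ?_ fun x => ?_
  · exact (symOp A).2
  · have hx : ∀ y : Euc n, y = ∑ i, y i • EuclideanSpace.single i (1 : ℝ) := by
      intro y
      ext j
      simp [Finset.sum_apply, Pi.single_apply]
    have h1 := hA (WithLp.toLp 2 x)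
    rw [hx (WithLp.toLp 2 x)] at h1
    simp only [map_sum, map_smul, sum_inner, inner_sum, real_inner_smul_left,
      inner_smul_right] at h1
    have h2 : star x ⬝ᵥ (symOp A : Matrix (Fin n) (Fin n) ℝ).mulVec x
        = ∑ i, ∑ j, x i * (x j * ⟪A (EuclideanSpace.single i 1), EuclideanSpace.single j 1⟫) := by
      have h3 : star x ⬝ᵥ (symOp A : Matrix (Fin n) (Fin n) ℝ).mulVec x
        = (∑ i, ∑ j, x i * (x j * ⟪A (EuclideanSpace.single i 1), EuclideanSpace.single j 1⟫)) / 2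
          + (∑ i, ∑ j, x j * (x i * ⟪A (EuclideanSpace.single j 1),
            EuclideanSpace.single i 1⟫)) / 2 := by
        simp only [dotProduct, Matrix.mulVec, symOp_apply, Finset.mul_sum, Finset.sum_div,
          ← Finset.sum_add_distrib]
        refine Finset.sum_congr rfl fun i _ => Finset.sum_congr rfl fun j _ => ?_
        simp only [star_trivial]
        ring
      rw [h3, Finset.sum_comm (f := fun i j => x j * (x i * ⟪A (EuclideanSpace.single j 1),
            EuclideanSpace.single i 1⟫))]
      ring
    rw [h2, Finset.sum_comm]
    simpa only [Finset.mul_sum, mul_left_comm] using h1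

/-- Adding to the closure of `U` a nonnegative matrix and an element of an open cone of directions
stable for `U` gives an element of `U`. -/
lemma closure_add_mem {U : Set (SymMat n)} (hUP : U + nonnegMatrices n ⊆ U) {ν : Euc n} {μ : ℝ}
    (hμ : U + halfCone μ ν ⊆ U) {X P A : SymMat n} {t : ℝ} (hX : X ∈ closure U)
    (hP : P ∈ nonnegMatrices n) (ht : 0 < t) (hA : opNorm A < μ) :
    X + P + t • (tensorSelf ν + A) ∈ U := by
  have hcont : Continuous fun Y : SymMat n => opNorm (A + t⁻¹ • (X - Y)) :=
    continuous_opNorm.comp (by fun_prop)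
  have hopen : IsOpen {Y : SymMat n | opNorm (A + t⁻¹ • (X - Y)) < μ} :=
    isOpen_lt hcont continuous_const
  -- The error `X - Y` of the approximation from `U` is absorbed into `A`, since `opNorm A < μ` is
  -- an open condition.
  obtain ⟨Y, hY, hYU⟩ := mem_closure_iff.1 hX _ hopen (by simpa using hA)
  have h1 : Y + P ∈ U := hUP (add_mem_add hYU hP)
  have h2 := hμ (add_mem_add h1 ⟨t, _, ht, hY, rfl⟩)
  have h3 : Y + P + t • (tensorSelf ν + (A + t⁻¹ • (X - Y))) = X + P + t • (tensorSelf ν + A) := by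
    simp only [smul_add, smul_smul, mul_inv_cancel₀ ht.ne', one_smul]
    abel
  rwa [h3] at h2

lemma LocLipMatrix.exists_opNorm_sub_le {Ω : Set (Euc n)} {L : Euc n × Euc n → SymMat n}
    (hL : LocLipMatrix Ω L) {D : Set (Euc n × Euc n)} (hD : IsCompact D)
    (hDΩ : D ⊆ Ω ×ˢ (univ : Set (Euc n))) :
    ∃ C : ℝ, 0 < C ∧ ∀ p ∈ D, ∀ q ∈ D, opNorm (L p - L q) ≤ C * dist p q := by
  have : ∀ i j : Fin n, ∃ K : ℝ≥0, LipschitzOnWith K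
      (fun p => (L p : Matrix (Fin n) (Fin n) ℝ) i j) D :=
    fun i j => ((hL i j).mono hDΩ).exists_lipschitzOnWith_of_compact hD
  choose K hK using this
  refine ⟨∑ i, ∑ j, (K i j : ℝ) + 1, by positivity, fun p hp q hq => ?_⟩
  refine (opNorm_le_sum_abs _).trans ?_
  calc _ ≤ ∑ i, ∑ j, (K i j : ℝ) * dist p q := by
        refine Finset.sum_le_sum fun i _ => Finset.sum_le_sum fun j _ => ?_
        exact (hK i j).dist_le_mul p hp q hq
    _ = (∑ i, ∑ j, (K i j : ℝ)) * dist p q := by simp only [Finset.sum_mul]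
    _ ≤ _ := by
      gcongr
      linarith

section Quadratic

variable (a : ℝ) (p z₀ : Euc n) (A : Euc n →L[ℝ] Euc n)

/-- The quadratic polynomial with value `a`, gradient `p` and second derivative `A` at `z₀`. -/
noncomputable def quadPoly (z : Euc n) : ℝ := a + ⟪p, z - z₀⟫ + ⟪A (z - z₀), z - z₀⟫ / 2

lemma contDiff_quadPoly : ContDiff ℝ 2 (quadPoly a p z₀ A) := by
  unfold quadPoly
  have h : ContDiff ℝ 2 fun z : Euc n => z - z₀ := by fun_prop
  exact (contDiff_const.add (contDiff_const.inner ℝ h)).add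
    (((A.contDiff.comp h).inner ℝ h).div_const 2)

lemma quadPoly_self : quadPoly a p z₀ A z₀ = a := by simp [quadPoly]

lemma hasFDerivAt_quadPoly (z : Euc n) : HasFDerivAt (quadPoly a p z₀ A)
    (innerSL ℝ p + (2⁻¹ : ℝ) • (innerSL ℝ (A (z - z₀)) + (innerSL ℝ (z - z₀)).comp A)) z := by
  have h0 : HasFDerivAt (fun z : Euc n => z - z₀) (ContinuousLinearMap.id ℝ (Euc n)) z :=
    (hasFDerivAt_id z).sub_const z₀
  have h1 : HasFDerivAt (fun z : Euc n => A (z - z₀)) A z := by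
    exact A.hasFDerivAt.comp z h0
  have h2 := ((((innerSL ℝ p).hasFDerivAt).comp z h0).const_add a).add
    ((h1.inner ℝ h0).const_mul (2⁻¹ : ℝ))
  refine (h2.congr_fderiv ?_).congr_of_eventuallyEq ?_
  · ext k
    simp [real_inner_comm, inner_sub_left, inner_sub_right]
    ring
  · refine Eventually.of_forall fun y => ?_
    simp only [quadPoly, Pi.add_apply, Function.comp_apply, innerSL_apply_apply]
    ring

lemma gradient_quadPoly : ∇ (quadPoly a p z₀ A) z₀ = p := by
  have : HasGradientAt (quadPoly a p z₀ A) p z₀ := by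
    rw [hasGradientAt_iff_hasFDerivAt]
    refine (hasFDerivAt_quadPoly a p z₀ A z₀).congr_fderiv ?_
    ext k
    simp
  exact this.gradient

lemma hessian_quadPoly (h : ContDiffAt ℝ 2 (quadPoly a p z₀ A) z₀) :
    hessian (quadPoly a p z₀ A) z₀ h = symOp A := by
  have h1 : fderiv ℝ (quadPoly a p z₀ A) = fun z => innerSL ℝ p +
      (2⁻¹ : ℝ) • (innerSL ℝ (A (z - z₀)) + (innerSL ℝ (z - z₀)).comp A) :=
    funext fun z => (hasFDerivAt_quadPoly a p z₀ A z).fderiv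
  have h2 : ∀ k k', fderiv ℝ (fderiv ℝ (quadPoly a p z₀ A)) z₀ k k' =
      (⟪A k, k'⟫ + ⟪A k', k⟫) / 2 := by
    intro k k'
    have hd : DifferentiableAt ℝ (fderiv ℝ (quadPoly a p z₀ A)) z₀ := by
      exact ((contDiff_quadPoly a p z₀ A).fderiv_right (m := 1) (by norm_num)).differentiable
        (by norm_num) z₀
    have h3 : fderiv ℝ (fderiv ℝ (quadPoly a p z₀ A)) z₀ k k' =
        fderiv ℝ (fun z => fderiv ℝ (quadPoly a p z₀ A) z k') z₀ k := by
      rw [fderiv_clm_apply hd (differentiableAt_const _)]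
      simp
    have h4 : (fun z => fderiv ℝ (quadPoly a p z₀ A) z k') = fun z => ⟪p, k'⟫ +
        ((2⁻¹ : ℝ) • (innerSL ℝ k' ∘L A + innerSL ℝ (A k'))) (z - z₀) := by
      rw [h1]
      ext z
      simp [real_inner_comm, inner_sub_right]
    rw [h3, h4, fderiv_const_add, fderiv_comp_sub, ContinuousLinearMap.fderiv]
    simp [real_inner_comm]
    ring
  ext i j
  rw [symOp_apply]
  exact h2 _ _

lemma opF_quadPoly (L : Euc n × Euc n → SymMat n) (h : ContDiffAt ℝ 2 (quadPoly a p z₀ A) z₀) :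
    opF L (quadPoly a p z₀ A) z₀ h = symOp A + L (z₀, p) := by
  rw [opF, hessian_quadPoly, gradient_quadPoly]

end Quadratic

end Matrices

/-! ### Estimates for sup-convolutions -/

section SupConvolution

variable {E : Type*} [NormedAddCommGroup E] [InnerProductSpace ℝ E]
  {B : Set E} {v : E → ℝ} {l : ℝ} {Z : E → E}

lemma exists_norm_smul_le (hB : IsCompact B) (hZ : ∀ x, Z x ∈ B) (l : ℝ) :
    ∃ K : ℝ≥0, ∀ x, ‖l • Z x‖ ≤ K := by
  obtain ⟨C, hC⟩ := hB.isBounded.exists_norm_le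
  refine ⟨Real.toNNReal (|l| * C), fun x => ?_⟩
  rw [norm_smul, Real.norm_eq_abs]
  refine le_trans ?_ (Real.le_coe_toNNReal _)
  gcongr
  exact hC _ (hZ x)

/-- At a point where the sup-convolution is twice differentiable, the original function is touched
from above by a paraboloid at the translated point. -/
lemma eventually_le_of_sup_convolution (hB : IsCompact B) (hZ : ∀ x, Z x ∈ B)
    (hmax : ∀ x, ∀ z ∈ B, v z + l * ⟪z, x⟫ - l / 2 * ‖z‖ ^ 2
      ≤ v (Z x) + l * ⟪Z x, x⟫ - l / 2 * ‖Z x‖ ^ 2) {x : E} (hx : B ∈ 𝓝 (Z x)) {A : E →L[ℝ] E}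
    (hA : HasFDerivAt (fun x => l • Z x) A x) {δ : ℝ} (hδ : 0 < δ) :
    ∀ᶠ z in 𝓝 (Z x), v z ≤ v (Z x) + ⟪l • (Z x - x), z - Z x⟫ +
      ⟪(A + (δ - l) • ContinuousLinearMap.id ℝ E) (z - Z x), z - Z x⟫ / 2 := by
  have hsel := isSubgradientSelection_sup_convolution hZ hmax
  obtain ⟨K, hK⟩ := exists_norm_smul_le hB hZ l
  have htay := hsel.taylor (hsel.lipschitz hK).continuous hA (half_pos hδ)
  have htend : Tendsto (fun z => z - Z x) (𝓝 (Z x)) (𝓝 0) := by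
    have : Tendsto (fun z => z - Z x) (𝓝 (Z x)) (𝓝 (Z x - Z x)) :=
      Continuous.tendsto (by fun_prop) _
    rwa [sub_self] at this
  filter_upwards [htend.eventually htay, hx] with z hz hzB
  have h1 := (abs_le.1 hz).2
  -- Translation trick: `x` is moved by the same vector as the maximizer, so the penalty stays fixed
  -- and the expansion at `x` becomes an upper bound for `v` near `Z x`.
  have h2 := hmax (x + (z - Z x)) z hzB
  obtain ⟨k, hk⟩ : ∃ k, z = Z x + k := ⟨z - Z x, by abel⟩
  subst hk
  simp only [add_sub_cancel_left] at h1 h2 ⊢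
  have h3 : ‖Z x + k‖ ^ 2 = ‖Z x‖ ^ 2 + 2 * ⟪Z x, k⟫ + ‖k‖ ^ 2 := norm_add_sq_real _ _
  simp only [h3, inner_add_left, inner_add_right, real_inner_smul_left, inner_sub_left,
    _root_.add_apply, _root_.smul_apply, ContinuousLinearMap.id_apply,
    real_inner_self_eq_norm_sq, real_inner_comm x k] at h1 h2 ⊢
  linarith

/-- Taking `x` itself as competitor gives `l/2 |Z x - x|² ≤ v (Z x) - v x ≤ K |Z x - x|`. -/
lemma norm_sup_convolution_sub_le (hl : 0 < l) {K : ℝ} (hK0 : 0 ≤ K)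
    (hK : ∀ x ∈ B, ∀ y ∈ B, v x - v y ≤ K * ‖x - y‖) (hZ : ∀ x, Z x ∈ B)
    (hmax : ∀ x, ∀ z ∈ B, v z + l * ⟪z, x⟫ - l / 2 * ‖z‖ ^ 2
      ≤ v (Z x) + l * ⟪Z x, x⟫ - l / 2 * ‖Z x‖ ^ 2) {x : E} (hx : x ∈ B) :
    l * ‖Z x - x‖ ≤ 2 * K := by
  have h1 := hmax x x hx
  have h2 := hK _ (hZ x) _ hx
  have h3 := norm_sub_sq_real (Z x) x
  rw [real_inner_self_eq_norm_sq] at h1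
  rcases (norm_nonneg (Z x - x)).eq_or_lt with h0 | h0
  · rw [← h0]; linarith
  · have h4 : ‖Z x - x‖ * (l * ‖Z x - x‖) ≤ ‖Z x - x‖ * (2 * K) := by nlinarith
    exact le_of_mul_le_mul_left h4 h0

/-- The maximum of `K t - l/2 t²` over `t` is `K² / (2 l)`; this bounds the gain from leaving `x`.
-/
lemma sup_convolution_le (hl : 0 < l) {K : ℝ}
    (hK : ∀ x ∈ B, ∀ y ∈ B, v x - v y ≤ K * ‖x - y‖) (hZ : ∀ x, Z x ∈ B) {x : E} (hx : x ∈ B) :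
    v (Z x) + l * ⟪Z x, x⟫ - l / 2 * ‖Z x‖ ^ 2 ≤ v x + l / 2 * ‖x‖ ^ 2 + K ^ 2 / (2 * l) := by
  have h2 := hK _ (hZ x) _ hx
  have h3 := norm_sub_sq_real (Z x) x
  have h4 : K * ‖Z x - x‖ - l / 2 * ‖Z x - x‖ ^ 2 ≤ K ^ 2 / (2 * l) := by
    rw [le_div_iff₀ (by positivity)]
    nlinarith [sq_nonneg (K - l * ‖Z x - x‖)]
  nlinarith

lemma le_sup_convolution
    (hmax : ∀ x, ∀ z ∈ B, v z + l * ⟪z, x⟫ - l / 2 * ‖z‖ ^ 2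
      ≤ v (Z x) + l * ⟪Z x, x⟫ - l / 2 * ‖Z x‖ ^ 2) {x : E} (hx : x ∈ B) :
    v x + l / 2 * ‖x‖ ^ 2 ≤ v (Z x) + l * ⟪Z x, x⟫ - l / 2 * ‖Z x‖ ^ 2 := by
  have h1 := hmax x x hx
  rw [real_inner_self_eq_norm_sq] at h1
  linarith

end SupConvolution

/-! ### Viscosity conditions for the convolutions -/

section Viscosity

variable {n : ℕ} {L : Euc n × Euc n → SymMat n} {U : Set (SymMat n)} {Ω B : Set (Euc n)} {l : ℝ}
  {Z : Euc n → Euc n}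

lemma IsClosed.mem_of_forall_add_smul_mem {V : Type*} [AddCommGroup V] [Module ℝ V]
    [TopologicalSpace V] [ContinuousAdd V] [ContinuousSMul ℝ V] {s : Set V} (hs : IsClosed s)
    {x y : V} (h : ∀ δ : ℝ, 0 < δ → x + δ • y ∈ s) : x ∈ s := by
  have h1 : Tendsto (fun δ : ℝ => x + δ • y) (𝓝[>] 0) (𝓝 x) := by
    have : Tendsto (fun δ : ℝ => x + δ • y) (𝓝 0) (𝓝 (x + (0 : ℝ) • y)) :=
      Continuous.tendsto (by fun_prop) 0
    rw [zero_smul, add_zero] at this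
    exact this.mono_left nhdsWithin_le_nhds
  refine hs.mem_of_tendsto h1 ?_
  filter_upwards [self_mem_nhdsWithin] with δ hδ using h δ hδ

/-- The sup-convolution of a subsolution is a subsolution of a perturbed equation, at points of
twice differentiability. -/
lemma ViscosityMemClosure.sup_convolution {v : Euc n → ℝ} (hFv : ViscosityMemClosure L U Ω v)
    (hB : IsCompact B) (hBΩ : B ⊆ Ω) (hZ : ∀ x, Z x ∈ B)
    (hmax : ∀ x, ∀ z ∈ B, v z + l * ⟪z, x⟫ - l / 2 * ‖z‖ ^ 2
      ≤ v (Z x) + l * ⟪Z x, x⟫ - l / 2 * ‖Z x‖ ^ 2) {x : Euc n} (hx : B ∈ 𝓝 (Z x))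
    {A : Euc n →L[ℝ] Euc n} (hA : HasFDerivAt (fun x => l • Z x) A x) :
    symOp A - l • symOp (ContinuousLinearMap.id ℝ (Euc n)) + L (Z x, l • (Z x - x)) ∈
      closure U := by
  -- The second-order expansion gives a touching paraboloid only after its Hessian is enlarged by `δ
  -- I`; closedness lets `δ` tend to zero.
  refine isClosed_closure.mem_of_forall_add_smul_mem
    (y := symOp (ContinuousLinearMap.id ℝ (Euc n))) fun δ hδ => ?_
  have h := hFv (Z x) (hBΩ (hZ x)) (quadPoly (v (Z x)) (l • (Z x - x)) (Z x)
    (A + (δ - l) • ContinuousLinearMap.id ℝ (Euc n))) (contDiff_quadPoly _ _ _ _).contDiffOn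
    (quadPoly_self _ _ _ _) (eventually_le_of_sup_convolution hB hZ hmax hx hA hδ)
    (contDiff_quadPoly _ _ _ _).contDiffAt
  rw [opF_quadPoly, symOp_add, symOp_smul] at h
  convert h using 1
  module

/-- The inf-convolution of a supersolution is a supersolution of a perturbed equation, at points of
twice differentiability. -/
lemma ViscosityNotMem.inf_convolution {u : Euc n → ℝ} (hFu : ViscosityNotMem L U Ω u)
    (hU : IsOpen U) (hB : IsCompact B) (hBΩ : B ⊆ Ω) (hZ : ∀ x, Z x ∈ B)
    (hmax : ∀ x, ∀ z ∈ B, -u z + l * ⟪z, x⟫ - l / 2 * ‖z‖ ^ 2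
      ≤ -u (Z x) + l * ⟪Z x, x⟫ - l / 2 * ‖Z x‖ ^ 2) {x : Euc n} (hx : B ∈ 𝓝 (Z x))
    {A : Euc n →L[ℝ] Euc n} (hA : HasFDerivAt (fun x => l • Z x) A x) :
    -symOp A + l • symOp (ContinuousLinearMap.id ℝ (Euc n)) + L (Z x, -(l • (Z x - x))) ∈ Uᶜ := by
  refine hU.isClosed_compl.mem_of_forall_add_smul_mem
    (y := -symOp (ContinuousLinearMap.id ℝ (Euc n))) fun δ hδ => ?_
  have h := hFu (Z x) (hBΩ (hZ x)) (quadPoly (u (Z x)) (-(l • (Z x - x))) (Z x)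
    (-(A + (δ - l) • ContinuousLinearMap.id ℝ (Euc n)))) (contDiff_quadPoly _ _ _ _).contDiffOn
    (quadPoly_self _ _ _ _) ?_ (contDiff_quadPoly _ _ _ _).contDiffAt
  · rw [opF_quadPoly, symOp_neg, symOp_add, symOp_smul] at h
    convert h using 1
    module
  · filter_upwards [eventually_le_of_sup_convolution (v := fun z => -u z) hB hZ hmax hx hA hδ]
      with z hz
    simp only [quadPoly, inner_neg_left, _root_.neg_apply]
    linarith

end Viscosity

/-! ### The Hopf barrier and the contradiction at a contact point -/

section Hopf

variable {n : ℕ}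

/-- The Hopf barrier is negative on the part of a small sphere outside the interior ball. -/
lemma barrier_neg {E : Type*} [NormedAddCommGroup E] [InnerProductSpace ℝ E] {ν y : E}
    (hν : ‖ν‖ = 1) {R r α : ℝ} (hR : 0 < R) (hr : 0 < r) (hα : 0 < α) (hαr : α * r ≤ 1 / 2)
    (hy : ‖y‖ = r) (hyR : R ≤ ‖y - R • ν‖) :
    ⟪ν, y⟫ + α * ⟪ν, y⟫ ^ 2 - R⁻¹ * ‖y‖ ^ 2 < 0 := by
  have h1 : R ^ 2 ≤ ‖y - R • ν‖ ^ 2 := by gcongr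
  rw [norm_sub_sq_real, norm_smul, hν, inner_smul_right, Real.norm_eq_abs, abs_of_pos hR, hy,
    real_inner_comm] at h1
  have h2 : |⟪ν, y⟫| ≤ r := by
    have := abs_real_inner_le_norm ν y
    rwa [hν, hy, one_mul] at this
  rw [hy]
  set s := ⟪ν, y⟫
  have h3 : 0 < R⁻¹ * r ^ 2 := by positivity
  have h4 : 2 * s ≤ R⁻¹ * r ^ 2 := by
    rw [inv_mul_eq_div, le_div_iff₀ hR]
    linarith
  obtain ⟨h5, h6⟩ := abs_le.1 h2
  rcases le_or_gt 0 s with hs | hs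
  · have : α * s ^ 2 ≤ 1 / 2 * s := by nlinarith [mul_le_mul_of_nonneg_left h6 (mul_nonneg hα.le hs)]
    linarith
  · have : α * s ^ 2 ≤ -(1 / 2 * s) := by nlinarith [mul_le_mul_of_nonneg_left h5 hα.le]
    linarith

lemma norm_gradient_barrier_le {E : Type*} [NormedAddCommGroup E] [InnerProductSpace ℝ E] {ν y : E}
    (hν : ‖ν‖ = 1) {κ r α : ℝ} (hκ : 0 < κ) (hα : 0 < α) (hαr : α * r ≤ 1 / 2)
    (hκr : κ * r ≤ 1 / 2) (hy : ‖y‖ ≤ r) :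
    ‖ν + (2 * α) • ⟪ν, y⟫ • ν - (2 * κ) • y‖ ≤ 4 := by
  have h2 : |⟪ν, y⟫| ≤ r := by
    have := abs_real_inner_le_norm ν y
    rw [hν, one_mul] at this
    exact this.trans hy
  calc _ ≤ ‖ν‖ + ‖(2 * α) • ⟪ν, y⟫ • ν‖ + ‖(2 * κ) • y‖ :=
        (norm_sub_le _ _).trans (by gcongr; exact norm_add_le _ _)
    _ = 1 + 2 * α * |⟪ν, y⟫| + 2 * κ * ‖y‖ := by
        rw [norm_smul, norm_smul, norm_smul, hν, Real.norm_eq_abs, Real.norm_eq_abs,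
          Real.norm_eq_abs, abs_of_pos (by positivity : 0 < 2 * α),
          abs_of_pos (by positivity : 0 < 2 * κ)]
        ring
    _ ≤ 1 + 2 * α * r + 2 * κ * r := by gcongr
    _ ≤ 4 := by linarith

/-- A subsolution cannot touch a supersolution from below at a boundary point of a ball in which
it is strictly smaller. -/
theorem false_of_interior_ball {Ω : Set (Euc n)} (hΩ : IsOpen Ω) {U : Set (SymMat n)}
    (hU : IsOpen U) (hUP : U + nonnegMatrices n ⊆ U) {L : Euc n × Euc n → SymMat n}
    (hL : LocLipMatrix Ω L) {u v : Euc n → ℝ} (hu : LocallyLipschitzOn Ω u)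
    (hv : LocallyLipschitzOn Ω v) (hFu : ViscosityNotMem L U Ω u)
    (hFv : ViscosityMemClosure L U Ω v) (huv : ∀ x ∈ Ω, v x ≤ u x) {x₀ ν : Euc n} (hx₀ : x₀ ∈ Ω)
    (hx₀uv : u x₀ = v x₀) (hν : ‖ν‖ = 1) (hUν : ConditionU U ν) {R : ℝ} (hR : 0 < R)
    (hball : ∀ z ∈ Ω, ‖z - x₀ - R • ν‖ < R → v z < u z) : False := by
  obtain ⟨μ, hμ0, hμ⟩ := hUν
  obtain ⟨r₁, hr₁, hr₁Ω⟩ := Metric.nhds_basis_closedBall.mem_iff.1 (hΩ.mem_nhds hx₀)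
  set B := Metric.closedBall x₀ r₁ with hB
  have hBc : IsCompact B := isCompact_closedBall _ _
  obtain ⟨Ku, hKu⟩ := (hu.mono hr₁Ω).exists_lipschitzOnWith_of_compact hBc
  obtain ⟨Kv, hKv⟩ := (hv.mono hr₁Ω).exists_lipschitzOnWith_of_compact hBc
  obtain ⟨K, hK0, hKu', hKv'⟩ : ∃ K : ℝ, 0 < K ∧
      (∀ x ∈ B, ∀ y ∈ B, -u x - -u y ≤ K * ‖x - y‖) ∧
      (∀ x ∈ B, ∀ y ∈ B, v x - v y ≤ K * ‖x - y‖) := by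
    refine ⟨Ku + Kv + 1, by positivity, fun x hx y hy => ?_, fun x hx y hy => ?_⟩
    · have h := hKu.dist_le_mul x hx y hy
      rw [Real.dist_eq, dist_eq_norm] at h
      have h1 := (abs_le.1 h).1
      have h2 : (Ku : ℝ) * ‖x - y‖ ≤ (Ku + Kv + 1) * ‖x - y‖ := by
        gcongr
        linarith [Kv.coe_nonneg]
      linarith
    · have h := hKv.dist_le_mul x hx y hy
      rw [Real.dist_eq, dist_eq_norm] at h
      have h1 := (abs_le.1 h).2
      have h2 : (Kv : ℝ) * ‖x - y‖ ≤ (Ku + Kv + 1) * ‖x - y‖ := by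
        gcongr
        linarith [Ku.coe_nonneg]
      linarith
  obtain ⟨C, hC0, hC⟩ := hL.exists_opNorm_sub_le
    (hBc.prod (isCompact_closedBall (0 : Euc n) (2 * K)))
    (prod_mono hr₁Ω (subset_univ _))
  set κ := R⁻¹ with hκ
  have hκ0 : 0 < κ := inv_pos.2 hR
  -- `2κ` comes from the Hessian of `-κ |z - x₀|²`, and `5C` from the change `5η` in the argument of
  -- `L`. Both errors scale with `η`, so `α` can be fixed before `η`.
  obtain ⟨α, hα0, hα⟩ : ∃ α : ℝ, 0 < α ∧ (2 * κ + 5 * C) < 2 * α * μ := by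
    refine ⟨(2 * κ + 5 * C) / μ, by positivity, ?_⟩
    rw [mul_assoc, div_mul_cancel₀ _ hμ0.ne']
    linarith [mul_pos two_pos hκ0]
  obtain ⟨r, hr0, hrr₁, hαr, hκr⟩ : ∃ r : ℝ, 0 < r ∧ r < r₁ ∧ α * r ≤ 1 / 2 ∧ κ * r ≤ 1 / 2 := by
    refine ⟨min (r₁ / 2) (1 / (2 * (α + κ))), by positivity, ?_, ?_, ?_⟩
    · exact (min_le_left _ _).trans_lt (by linarith)
    · calc _ ≤ α * (1 / (2 * (α + κ))) := by gcongr; exact min_le_right _ _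
        _ = (1 / 2) * (α / (α + κ)) := by field_simp
        _ ≤ (1 / 2) * 1 := by
          gcongr
          rw [div_le_one (by positivity)]
          linarith
        _ = _ := mul_one _
    · calc _ ≤ κ * (1 / (2 * (α + κ))) := by gcongr; exact min_le_right _ _
        _ = (1 / 2) * (κ / (α + κ)) := by field_simp
        _ ≤ (1 / 2) * 1 := by
          gcongr
          rw [div_le_one (by positivity)]
          linarith
        _ = _ := mul_one _
  have hsB : Metric.closedBall x₀ r ⊆ B := Metric.closedBall_subset_closedBall hrr₁.le
  have hx₀B : x₀ ∈ B := Metric.mem_closedBall_self hr₁.le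
  set h : Euc n → ℝ := fun z => ⟪ν, z - x₀⟫ + α * ⟪ν, z - x₀⟫ ^ 2 - κ * ‖z - x₀‖ ^ 2 with hh
  have hhc : Continuous h := by fun_prop
  have huvc : ContinuousOn (fun z => u z - v z) B :=
    (hKu.continuousOn).sub (hKv.continuousOn)
  have hSB : Metric.sphere x₀ r ⊆ B := Metric.sphere_subset_closedBall.trans hsB
  -- By `barrier_neg` the part of the sphere with `h ≥ 0` lies inside the interior ball, where `u -
  -- v` is positive; compactness gives a uniform bound.
  obtain ⟨m, hm0, hm⟩ : ∃ m : ℝ, 0 < m ∧ ∀ z ∈ Metric.sphere x₀ r ∩ h ⁻¹' Ici 0, m ≤ u z - v z := by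
    refine IsCompact.exists_forall_le' ((isCompact_sphere x₀ r).inter_right
      (isClosed_Ici.preimage hhc)) (huvc.mono (inter_subset_left.trans hSB)) fun z hz => ?_
    rw [sub_pos]
    refine hball z (hr₁Ω (hSB hz.1)) ?_
    by_contra! hcon
    have := barrier_neg hν hR hr0 hα0 hαr (mem_sphere_iff_norm.1 hz.1) hcon
    exact absurd hz.2 (not_le.2 this)
  -- On the sphere `h ≤ r + r / 2`, so this choice keeps `η * h` below `m`.
  obtain ⟨η, hη0, hη⟩ : ∃ η : ℝ, 0 < η ∧ η * (2 * r) < m := by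
    refine ⟨m / (4 * r), by positivity, ?_⟩
    have : m / (4 * r) * (2 * r) = m / 2 := by field_simp; norm_num
    rw [this]
    linarith
  obtain ⟨m', hm'0, hm'⟩ : ∃ m' : ℝ, 0 < m' ∧ ∀ z ∈ Metric.sphere x₀ r,
      m' ≤ u z - v z - η * h z := by
    refine IsCompact.exists_forall_le' (isCompact_sphere x₀ r)
      ((huvc.mono hSB).sub (by fun_prop)) fun z hz => ?_
    refine sub_pos.2 (?_ : η * h z < u z - v z)
    rcases le_or_gt 0 (h z) with h0 | h0
    · refine lt_of_lt_of_le ?_ (hm z ⟨hz, h0⟩)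
      refine lt_of_le_of_lt ?_ hη
      gcongr
      have hz' := mem_sphere_iff_norm.1 hz
      have h1 := abs_real_inner_le_norm ν (z - x₀)
      rw [hν, one_mul, hz'] at h1
      have h2 : α * ⟪ν, z - x₀⟫ ^ 2 ≤ α * r * r := by
        rw [mul_assoc, ← sq, ← sq_abs]
        gcongr
      have h3 : 0 ≤ κ * ‖z - x₀‖ ^ 2 := by positivity
      have h4 : α * r * r ≤ 1 / 2 * r := by gcongr
      simp only [hh]
      linarith [(abs_le.1 h1).2]
    · have h1 := huv z (hr₁Ω (hSB hz))
      have := mul_neg_of_pos_of_neg hη0 h0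
      linarith
  -- Respectively: the two convolution errors do not destroy the gap `m'` on the sphere; `Z₁ x` and
  -- `Z₂ x` are within `η` of each other; both stay in the interior of `B`.
  obtain ⟨l, hl0, hl1, hl2, hl3⟩ : ∃ l : ℝ, 0 < l ∧ K ^ 2 < l * m' ∧ 4 * K ≤ l * η ∧
      2 * K < l * (r₁ - r) := by
    have hrr : 0 < r₁ - r := sub_pos.2 hrr₁
    have := ((((tendsto_id (α := ℝ) (x := atTop)).atTop_mul_const hm'0).eventually_gt_atTop
      (K ^ 2)).and (((tendsto_id.atTop_mul_const hη0).eventually_ge_atTop (4 * K)).and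
      ((tendsto_id.atTop_mul_const hrr).eventually_gt_atTop (2 * K)))).and (eventually_gt_atTop 0)
    obtain ⟨l, ⟨h1, h2, h3⟩, h4⟩ := this.exists
    exact ⟨l, h4, h1, h2, h3⟩
  obtain ⟨Z₁, hZ₁, hmax₁⟩ := exists_sup_convolution hBc ⟨x₀, hx₀B⟩ hKv.continuousOn l
  obtain ⟨Z₂, hZ₂, hmax₂⟩ := exists_sup_convolution hBc ⟨x₀, hx₀B⟩ (v := fun z => -u z)
    hKu.continuousOn.neg l
  obtain ⟨K₁, hK₁⟩ := exists_norm_smul_le hBc hZ₁ l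
  obtain ⟨K₂, hK₂⟩ := exists_norm_smul_le hBc hZ₂ l
  have hnear : ∀ {Z : Euc n → Euc n} {x : Euc n}, l * ‖Z x - x‖ ≤ 2 * K → x ∈ Metric.ball x₀ r →
      B ∈ 𝓝 (Z x) := by
    intro Z x hZx hx
    refine mem_of_superset (Metric.isOpen_ball.mem_nhds (x := Z x) ?_)
      Metric.ball_subset_closedBall
    rw [mem_ball_iff_norm] at hx ⊢
    have h1 : ‖Z x - x‖ < r₁ - r := lt_of_mul_lt_mul_left (hZx.trans_lt hl3) hl0.le
    calc _ = ‖(Z x - x) + (x - x₀)‖ := by congr 1; abel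
      _ ≤ ‖Z x - x‖ + ‖x - x₀‖ := norm_add_le _ _
      _ < r₁ := by linarith
  set N : Euc n →L[ℝ] Euc n := (innerSL ℝ ν).smulRight ν with hN
  set I := ContinuousLinearMap.id ℝ (Euc n) with hI
  -- `Q` is the Hessian of `η h` minus `2l I`. The latter, with the slope `-(2l) x₀` below, cancels
  -- the two terms `l/2 |x|²` up to a constant, so the function maximized is the convolved `v - u`
  -- plus `η h`.
  set Q : Euc n →L[ℝ] Euc n := (2 * η * α) • N - (2 * η * κ + 2 * l) • I with hQ
  have hQinner : ∀ x y, ⟪Q x, y⟫ = 2 * η * α * (⟪ν, x⟫ * ⟪ν, y⟫) - (2 * η * κ + 2 * l) * ⟪x, y⟫ := by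
    intro x y
    simp [hQ, hN, hI, inner_sub_left, real_inner_smul_left]
  obtain ⟨x, hx, A₁, A₂, hA₁, hA₂, hT, hle⟩ := exists_twice_differentiable_near_max
    (isSubgradientSelection_sup_convolution hZ₁ hmax₁) hK₁
    (isSubgradientSelection_sup_convolution hZ₂ hmax₂) hK₂ Q
    (fun x y => by rw [hQinner, hQinner, real_inner_comm x y]; ring) (η • ν - (2 * l) • x₀) x₀
    hr0 hη0 (by
      intro z hz
      have e1 := sup_convolution_le hl0 hKv' hZ₁ (hSB hz)
      have e2 := sup_convolution_le hl0 hKu' hZ₂ (hSB hz)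
      have e3 := le_sup_convolution hmax₁ hx₀B
      have e4 := le_sup_convolution hmax₂ hx₀B
      have e5 := hm' z hz
      have e6 : K ^ 2 / (2 * l) < m' / 2 := by
        rw [div_lt_iff₀ (by positivity)]
        linarith
      have e7 : ‖z‖ ^ 2 = ‖x₀‖ ^ 2 + 2 * ⟪x₀, z - x₀⟫ + ‖z - x₀‖ ^ 2 := by
        rw [← norm_add_sq_real, add_sub_cancel]
      simp only [hh] at e5
      rw [hQinner, inner_sub_left, real_inner_smul_left, real_inner_smul_left,
        real_inner_self_eq_norm_sq]
      rw [e7] at e1 e2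
      linarith)
  have hxB : x ∈ B := hsB (Metric.ball_subset_closedBall hx)
  have hd₁ := norm_sup_convolution_sub_le hl0 hK0.le hKv' hZ₁ hmax₁ hxB
  have hd₂ := norm_sup_convolution_sub_le hl0 hK0.le hKu' hZ₂ hmax₂ hxB
  have hF₁ := hFv.sup_convolution hBc hr₁Ω hZ₁ hmax₁ (hnear hd₁ hx) hA₁
  have hF₂ := hFu.inf_convolution hU hBc hr₁Ω hZ₂ hmax₂ (hnear hd₂ hx) hA₂
  have hp : ∀ {Z : Euc n → Euc n}, l * ‖Z x - x‖ ≤ 2 * K → ‖l • (Z x - x)‖ ≤ 2 * K := by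
    intro Z hZ
    rwa [norm_smul, Real.norm_eq_abs, abs_of_pos hl0]
  -- The gradients differ by `η ∇h` minus the near-maximum error `T`, hence by at most `4η + η`.
  have hdist : dist (Z₂ x, -(l • (Z₂ x - x))) (Z₁ x, l • (Z₁ x - x)) ≤ 5 * η := by
    rw [Prod.dist_eq]
    refine max_le ?_ ?_
    · rw [dist_eq_norm]
      have h1 : ‖Z₂ x - Z₁ x‖ ≤ ‖Z₂ x - x‖ + ‖Z₁ x - x‖ := by
        calc _ = ‖(Z₂ x - x) - (Z₁ x - x)‖ := by congr 1; abel
          _ ≤ _ := norm_sub_le _ _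
      have h2 : l * ‖Z₂ x - Z₁ x‖ ≤ l * η := by nlinarith
      have h3 := le_of_mul_le_mul_left h2 hl0
      linarith
    · rw [dist_eq_norm]
      have h1 := norm_gradient_barrier_le hν hκ0 hα0 hαr hκr
        (mem_ball_iff_norm.1 hx).le
      set T := l • Z₁ x + l • Z₂ x + (η • ν - (2 * l) • x₀ + Q (x - x₀)) with hTdef
      have h2 : -(l • (Z₂ x - x)) - l • (Z₁ x - x) =
          η • (ν + (2 * α) • ⟪ν, x - x₀⟫ • ν - (2 * κ) • (x - x₀)) - T := by
        have hQx : Q (x - x₀) = (2 * η * α) • ⟪ν, x - x₀⟫ • ν - (2 * η * κ + 2 * l) • (x - x₀) := rfl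
        rw [hTdef, hQx]
        module
      rw [h2]
      refine (norm_sub_le _ _).trans ?_
      rw [norm_smul, Real.norm_eq_abs, abs_of_pos hη0]
      nlinarith
  have hLdiff := hC (Z₂ x, -(l • (Z₂ x - x)))
    ⟨hZ₂ x, by rw [mem_closedBall_zero_iff, norm_neg]; exact hp hd₂⟩ (Z₁ x, l • (Z₁ x - x))
    ⟨hZ₁ x, by rw [mem_closedBall_zero_iff]; exact hp hd₁⟩
  have hP : symOp (-(A₁ + A₂ + Q)) ∈ nonnegMatrices n := by
    refine symOp_mem_nonnegMatrices fun k => ?_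
    have := hle k
    simp only [_root_.neg_apply, _root_.add_apply, inner_neg_left, inner_add_left]
    linarith
  set D := L (Z₂ x, -(l • (Z₂ x - x))) - L (Z₁ x, l • (Z₁ x - x)) with hD
  have hηα : 0 < 2 * η * α := by positivity
  have hAnorm : opNorm ((2 * η * α)⁻¹ • (-(2 * η * κ) • symOp I + D)) < μ := by
    rw [opNorm_smul, abs_of_pos (inv_pos.2 hηα), inv_mul_lt_iff₀ hηα]
    have h1 : opNorm (-(2 * η * κ) • symOp I + D) ≤ 2 * η * κ * 1 + C * (5 * η) := by
      refine (opNorm_add_le _ _).trans ?_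
      rw [opNorm_smul, abs_neg, abs_of_pos (by positivity)]
      gcongr
      · exact opNorm_symOp_id_le
      · exact hLdiff.trans (by gcongr)
    refine h1.trans_lt ?_
    nlinarith
  -- The matrix of `u` is that of `v` plus the nonnegative matrix from the maximum condition plus
  -- `2ηα (ν ⊗ ν)` with a small perturbation, so it lies in `U`, against `hF₂`.
  have hmem := closure_add_mem hUP hμ hF₁ hP hηα hAnorm
  apply hF₂
  convert hmem using 1
  rw [symOp_neg, symOp_add, symOp_add, hQ, symOp_sub, symOp_smul, symOp_smul, hN, symOp_smulRight,
    smul_add, smul_smul, mul_inv_cancel₀ hηα.ne', one_smul, hD]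
  module

end Hopf

/-! ### Connectedness and construction of an interior ball -/

theorem theorem1p2 (n : ℕ) (hn : 2 ≤ n)
    (Ω : Set (Euc n)) (hΩ : IsOpen Ω) (hΩc : IsConnected Ω)
    (U : Set (SymMat n)) (hU : IsOpen U) (hU0 : (0 : SymMat n) ∈ frontier U)
    (hUP : U + nonnegMatrices n ⊆ U) (hUt : ∀ t : ℝ, 0 < t → t • U ⊆ U)
    (hUν : ∀ ν : Euc n, ‖ν‖ = 1 → ConditionU U ν)
    (L : Euc n × Euc n → SymMat n) (hL : LocLipMatrix Ω L)
    (u v : Euc n → ℝ) (hu : LocallyLipschitzOn Ω u) (hv : LocallyLipschitzOn Ω v)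
    (hFu : ViscosityNotMem L U Ω u) (hFv : ViscosityMemClosure L U Ω v)
    (huv : ∀ x ∈ Ω, v x ≤ u x) :
    (∀ x ∈ Ω, v x < u x) ∨ (∀ x ∈ Ω, u x = v x) := by
  by_contra! hcon
  obtain ⟨⟨z₁, hz₁, hz₁'⟩, z₂, hz₂, hz₂'⟩ := hcon
  have hwc : ContinuousOn (fun z => u z - v z) Ω := hu.continuousOn.sub hv.continuousOn
  -- Otherwise the positive set and the complement of its closure would be two open sets
  -- disconnecting `Ω`.
  obtain ⟨z, hzΩ, hz0, hzcl⟩ : ∃ z ∈ Ω, u z = v z ∧ z ∈ closure {y ∈ Ω | v y < u y} := by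
    by_contra! hno
    have hpos : IsOpen (Ω ∩ (fun z => u z - v z) ⁻¹' Ioi 0) :=
      hwc.isOpen_inter_preimage hΩ isOpen_Ioi
    have hpre := hΩc.isPreconnected (Ω ∩ (fun z => u z - v z) ⁻¹' Ioi 0)
      (closure {y ∈ Ω | v y < u y})ᶜ hpos isClosed_closure.isOpen_compl
      (fun y hy => by
        rcases (huv y hy).lt_or_eq with h | h
        · exact Or.inl ⟨hy, sub_pos.2 h⟩
        · exact Or.inr (hno y hy h.symm))
      ⟨z₂, hz₂, hz₂, sub_pos.2 (lt_of_le_of_ne (huv z₂ hz₂) (Ne.symm hz₂'))⟩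
      ⟨z₁, hz₁, hno z₁ hz₁ (le_antisymm hz₁' (huv z₁ hz₁))⟩
    obtain ⟨y, hy, hy1, hy2⟩ := hpre
    exact hy2 (subset_closure ⟨hy, sub_pos.1 hy1.2⟩)
  obtain ⟨ρ, hρ, hρΩ⟩ := Metric.nhds_basis_closedBall.mem_iff.1 (hΩ.mem_nhds hzΩ)
  -- Within `ρ / 2` of `z`, the ball about `y` reaching the nearest zero stays in `closedBall z ρ`.
  -- Minimality over that compact ball therefore excludes every zero in the open ball about `y`.
  obtain ⟨y, ⟨hyΩ, hy⟩, hyz⟩ := Metric.mem_closure_iff.1 hzcl (ρ / 2) (half_pos hρ)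
  have hcomp : IsCompact (Metric.closedBall z ρ ∩ (fun z => u z - v z) ⁻¹' {0}) :=
    (isCompact_closedBall z ρ).of_isClosed_subset
      ((hwc.mono hρΩ).preimage_isClosed_of_isClosed Metric.isClosed_closedBall isClosed_singleton)
      inter_subset_left
  obtain ⟨x₀, ⟨hx₀ρ, hx₀⟩, hmin⟩ := hcomp.exists_isMinOn
    ⟨z, Metric.mem_closedBall_self hρ.le, sub_eq_zero.2 hz0⟩ (f := fun x => dist y x) (by fun_prop)
  have hx₀' : u x₀ = v x₀ := sub_eq_zero.1 hx₀
  have hyx : y ≠ x₀ := by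
    rintro rfl
    exact hy.ne' hx₀'
  have hR : 0 < ‖y - x₀‖ := norm_pos_iff.2 (sub_ne_zero.2 hyx)
  have hRz : dist y x₀ ≤ dist y z := hmin ⟨Metric.mem_closedBall_self hρ.le, sub_eq_zero.2 hz0⟩
  have hν : ‖‖y - x₀‖⁻¹ • (y - x₀)‖ = 1 := by
    rw [norm_smul, norm_inv, norm_norm, inv_mul_cancel₀ hR.ne']
  refine false_of_interior_ball hΩ hU hUP hL hu hv hFu hFv huv (hρΩ hx₀ρ) hx₀' hν (hUν _ hν) hR
    fun p hpΩ hp => ?_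
  rw [smul_smul, mul_inv_cancel₀ hR.ne', one_smul, sub_sub_sub_cancel_right, ← dist_eq_norm,
    ← dist_eq_norm] at hp
  refine lt_of_le_of_ne (huv p hpΩ) fun hpe => ?_
  have hpρ : p ∈ Metric.closedBall z ρ := by
    rw [Metric.mem_closedBall]
    have h1 := dist_triangle p y z
    rw [dist_comm z y] at hyz
    linarith
  have : dist y x₀ ≤ dist y p := hmin ⟨hpρ, sub_eq_zero.2 hpe.symm⟩
  rw [dist_comm y p] at this
  exact absurd hp (not_lt.2 this)
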